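/- For a family $\mathcal F$ of graphs containing $K_2$, a graph $G$ and an integer $n\ge |V(G)|$, let $f(n,G\mid\mathcal F)$ be the smallest integer $m$ such that every edge coloring of the complete graph $K_n$ using at least $m$ colors contains a copy of $G$ in which every color class (the graph formed by all edges of the copy having one given color that occurs in it, together with their end vertices) is isomorphic to a member of $\mathcal F$. Let $\mathrm{ex}(n,K_q)$ be the maximum number of edges of an $n$-vertex graph that contains no $K_q$. Let $r\ge 1$ and $p$ be integers such that either $r\ge 2$ and $p>2r$, or $r=1$ and $p\ge 4$. Let $\mathcal F^*_r=\{mK_2 : 1\le m\le r\}$ be the family of matchings with at least one and at most $r$ edges. Then $$\mathrm{ex}(n,K_{p-r})+2\ \le\ f(n,K_p\mid\mathcal F^*_r)\ \le\ (1+o(1))\,\mathrm{ex}(n,K_{p-r}),$$ where the lower bound holds for every $n\ge p$, and $o(1)$ denotes a quantity tending to $0$ as $n\to\infty$ with $p$ and $r$ fixed. The same lower and upper bounds hold for $f(n,K_p\mid\mathcal F)$, where $\mathcal F$ is obtained from $\mathcal F^*_r$ by adding all triangle-free graphs without isolated vertices, connected or disconnected, that are not matchings. (Thus the matchings with more than $r$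 edges are not in $\mathcal F$.) -/

import Mathlib

open SimpleGraph

/-- A family of finite graphs, given by representatives on the vertex sets `Fin m`. -/
abbrev GraphFamily := Set (Σ m : ℕ, SimpleGraph (Fin m))

/-- `H` is a member of the family, up to isomorphism. -/
def GraphFamily.Has (𝓕 : GraphFamily) {V : Type*} (H : SimpleGraph V) : Prop :=
  ∃ F ∈ 𝓕, Nonempty (H ≃g F.2)

/-- The graph spanned by a set of edges, here given as the edge set of a graph `H`: its vertices
are the end points of the edges of `H`, so it has no isolated vertices. -/
abbrev spanned {V : Type*} (H : SimpleGraph V) : SimpleGraph H.support :=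
  H.induce H.support

/-- An edge coloring of `K_n`: the color of the edge `uv` is `c s(u, v)`. The values of `c` on
the diagonal of `Sym2 (Fin n)` are not colors of edges and are never looked at. -/
abbrev EdgeColoring (n : ℕ) := Sym2 (Fin n) → ℕ

/-- The number of colors that occur on the edges of `K_n`. -/
noncomputable def EdgeColoring.numColors {n : ℕ} (c : EdgeColoring n) : ℕ :=
  (c '' (completeGraph (Fin n)).edgeSet).ncard

/-- The edges of color `k` in the copy `φ` of `G` in `K_n`, viewed as edges of `G`. -/
def colorClass {V : Type*} {G : SimpleGraph V} {n : ℕ} (c : EdgeColoring n)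
    (φ : Copy G (completeGraph (Fin n))) (k : ℕ) : SimpleGraph V where
  Adj u v := G.Adj u v ∧ c s(φ u, φ v) = k
  symm := ⟨fun _ _ h => ⟨h.1.symm, Sym2.eq_swap ▸ h.2⟩⟩
  loopless := ⟨fun _ h => G.loopless.irrefl _ h.1⟩

/-- All (nonempty) color classes of the copy `φ` of `G` in `K_n` are members of `𝓕`. -/
def IsDecomposedCopy (𝓕 : GraphFamily) {V : Type*} {G : SimpleGraph V} {n : ℕ}
    (c : EdgeColoring n) (φ : Copy G (completeGraph (Fin n))) : Prop :=
  ∀ k : ℕ, colorClass c φ k ≠ ⊥ → 𝓕.Has (spanned (colorClass c φ k))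

/-- `f(n, G | 𝓕)`: the smallest `m` such that every edge coloring of `K_n` that uses at least `m`
colors contains a copy of `G` all of whose color classes are members of `𝓕`.
(The set is never empty: it contains every `m` larger than the number of edges of `K_n`.) -/
noncomputable def genAntiRamsey (n : ℕ) {V : Type*} (G : SimpleGraph V) (𝓕 : GraphFamily) : ℕ :=
  sInf {m : ℕ | ∀ c : EdgeColoring n, m ≤ c.numColors →
    ∃ φ : Copy G (completeGraph (Fin n)), IsDecomposedCopy 𝓕 c φ}

/-- The matching `m K_2`: `m` vertex-disjoint edges `(i, 0)(i, 1)`, and no further vertices. -/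
def matchingGraph (m : ℕ) : SimpleGraph (Fin m × Fin 2) :=
  SimpleGraph.fromRel fun x y => x.1 = y.1

/-- The family `{m K_2 | 1 ≤ m ≤ r}`. -/
def smallMatchings (r : ℕ) : GraphFamily :=
  {F | ∃ m, 1 ≤ m ∧ m ≤ r ∧ Nonempty (F.2 ≃g matchingGraph m)}

/-- All triangle-free graphs, without isolated vertices, that are not matchings. -/
def nonMatchingTriangleFree : GraphFamily :=
  {F | F.2.CliqueFree 3 ∧ (∀ v, ∃ w, F.2.Adj v w) ∧ ∀ m, ¬ Nonempty (F.2 ≃g matchingGraph m)}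

/-! Put q = p - r; the hypotheses give q ≥ 3 and r ≤ q. Lower bound: make the Turán graph with q - 1
parts rainbow and give all other edges one extra color. In a copy of K_p the extra color forms
disjoint cliques, at most q - 1 counting single vertices. So it contains a triangle or is a matching
of at least r + 1 edges (`card_le_of_iso_matchingGraph`), and neither is allowed. Upper bound: keep
one edge of each color. By Erdős-Stone, (1 + o(1)) ex(n, K_q) colors force a rainbow blow-up of K_q
whose parts consist of q + 1 pairs. A union bound (`exists_choice_avoiding`) selects one pair per
part so that no inner edge of a pair shares its color with an edge between selected pairs. Take both
vertices of r pairs and one vertex of each other pair: this is a K_p in which a crossing edge is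
alone in its color, and every other class consists of some of the r disjoint inner edges. -/

/-! ### Extremal numbers of cliques and their blow-ups. -/

theorem extremalNumber_succ_le_of_minDegree {W : Type*} {H : SimpleGraph W} {n : ℕ} {δ : ℝ}
    (hδ : 0 ≤ δ) (h : ∀ (G : SimpleGraph (Fin (n + 1))) [DecidableRel G.Adj],
      H.Free G → (G.minDegree : ℝ) ≤ δ) :
    (extremalNumber (n + 1) H : ℝ) ≤ extremalNumber n H + δ := by
  classical
  have key := extremalNumber_le_iff_of_nonneg (V := Fin (n + 1)) H
    (m := (extremalNumber n H : ℝ) + δ) (by positivity)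
  rw [Fintype.card_fin] at key
  rw [key]
  intro G _ hG
  obtain ⟨v, hv⟩ := G.exists_minimal_degree_vertex
  have h1 := card_edgeFinset_deleteIncidenceSet_le_extremalNumber hG v
  rw [card_edgeFinset_deleteIncidenceSet, Fintype.card_fin, Nat.add_sub_cancel,
    tsub_le_iff_right, ← hv] at h1
  have h2 := h G hG
  have h3 : (G.edgeFinset.card : ℝ) ≤ extremalNumber n H + G.minDegree := by
    exact_mod_cast h1
  linarith

theorem eventually_mul_le_mul_choose_two (A : ℝ) {ε : ℝ} (hε : 0 < ε) :
    ∀ᶠ n : ℕ in Filter.atTop, A * (n + 1) ≤ ε * (n.choose 2 : ℝ) := by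
  filter_upwards [Filter.eventually_ge_atTop (⌈2 * A / ε⌉₊ + 2)] with n hn
  have h1 : 2 * A / ε + 2 ≤ n := by
    have := Nat.le_ceil (2 * A / ε)
    have h2 : ((⌈2 * A / ε⌉₊ + 2 : ℕ) : ℝ) ≤ n := by exact_mod_cast hn
    push_cast at h2
    linarith
  -- The factor n - 2 suffices because (n - 2)(n + 1) ≤ n(n - 1).
  have h2 : 2 * A ≤ (n - 2) * ε := by
    rw [← div_le_iff₀ hε]
    linarith
  rw [Nat.cast_choose_two]
  have h3 : (0 : ℝ) ≤ n := n.cast_nonneg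
  nlinarith [mul_le_mul_of_nonneg_right h2 (by linarith : (0 : ℝ) ≤ n + 1)]

/-- The upper bound in the **Erdős-Stone theorem**. -/
theorem eventually_extremalNumber_completeEquipartiteGraph_le {ρ : ℕ} (hρ : 1 ≤ ρ) (t : ℕ)
    {ε : ℝ} (hε : 0 < ε) :
    ∀ᶠ n : ℕ in Filter.atTop, (extremalNumber n (completeEquipartiteGraph (ρ + 1) t) : ℝ) ≤
      (1 - 1 / ρ + ε) * (n.choose 2 : ℝ) := by
  set H := completeEquipartiteGraph (ρ + 1) t
  obtain ⟨N, hN⟩ := Filter.eventually_atTop.mp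
    (eventually_completeEquipartiteGraph_isContained_of_minDegree (half_pos hε) ρ t)
  set α : ℝ := 1 - 1 / ρ + ε / 2 with hα
  have hα0 : 0 ≤ α := by
    have : (1 : ℝ) / ρ ≤ 1 := by
      rw [div_le_one (by positivity)]
      exact_mod_cast hρ
    linarith
  -- Delete vertices of minimum degree until N remain: the minimum-degree form of Erdős-Stone bounds
  -- each loss by α times the current order, and these sum to at most α n(n + 1)/2.
  have hbound : ∀ n, N ≤ n →
      (extremalNumber n H : ℝ) ≤ extremalNumber N H + α * (n * (n + 1) / 2) := by
    intro n hn
    induction n, hn using Nat.le_induction with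
    | base => simp only [le_add_iff_nonneg_right]; positivity
    | succ n hn ih =>
      have := extremalNumber_succ_le_of_minDegree (H := H) (n := n) (δ := α * (n + 1))
        (by positivity) (by
          intro G _ hG
          by_contra! hlt
          refine hG (hN (n + 1) (by omega) (G := G) ?_)
          push_cast
          exact hlt.le)
      push_cast
      nlinarith
  filter_upwards [Filter.eventually_ge_atTop N,
    eventually_mul_le_mul_choose_two (extremalNumber N H + α) (half_pos hε)] with n hn h1
  have h2 := hbound n hn
  have h3 : (0 : ℝ) ≤ (extremalNumber N H : ℝ) * n := by positivity
  have h4 : (n * (n + 1) / 2 : ℝ) = n.choose 2 + n := by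
    rw [Nat.cast_choose_two]; ring
  rw [h4] at h2
  have h5 : (1 - 1 / ρ + ε) * (n.choose 2 : ℝ) = α * n.choose 2 + ε / 2 * n.choose 2 := by
    rw [hα]; ring
  rw [h5]
  nlinarith

/-- The density ex(n, K)/C(n, 2) does not increase with n, so n may be replaced by ρn, where the
Turán graph has equal parts and its edges are counted exactly. -/
theorem le_extremalNumber_completeGraph {ρ : ℕ} (hρ : 1 ≤ ρ) {n : ℕ} (hn : 2 ≤ n) :
    (1 - 1 / ρ) * (n.choose 2 : ℝ) ≤ extremalNumber n (completeGraph (Fin (ρ + 1))) := by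
  have : Nontrivial (Fin (ρ + 1)) := Fin.nontrivial_iff_two_le.mpr (by omega)
  have hle : n ≤ ρ * n := Nat.le_mul_of_pos_left n hρ
  have h1 := antitoneOn_extremalNumber_div_choose_two (completeGraph (Fin (ρ + 1)))
    (Set.mem_Ici.mpr hn) (Set.mem_Ici.mpr (hn.trans hle)) hle
  have hpos : (0 : ℝ) < n.choose 2 := by exact_mod_cast Nat.choose_pos hn
  rw [← le_div_iff₀ hpos]
  refine le_trans ?_ h1
  have h2 : extremalNumber (ρ * n) (completeGraph (Fin (ρ + 1))) = ρ.choose 2 * n ^ 2 := by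
    rw [extremalNumber_top, Fintype.card_fin, Nat.add_sub_cancel,
      ← card_edgeFinset_completeEquipartiteGraph]
    exact (completeEquipartiteGraph.turanGraph (r := ρ) (t := n)).card_edgeFinset_eq.symm
  have hρ' : (1 : ℝ) ≤ ρ := by exact_mod_cast hρ
  have hn' : (2 : ℝ) ≤ n := by exact_mod_cast hn
  beta_reduce
  rw [h2, le_div_iff₀ (by exact_mod_cast Nat.choose_pos (hn.trans hle))]
  push_cast
  rw [Nat.cast_choose_two, Nat.cast_choose_two]
  push_cast
  have h3 : (1 - 1 / (ρ : ℝ)) * (ρ * n * (ρ * n - 1) / 2) = (ρ - 1) * n * (ρ * n - 1) / 2 := by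
    field_simp
  rw [h3]
  nlinarith [mul_nonneg (sub_nonneg.mpr hρ') (by linarith : (0 : ℝ) ≤ n)]

/-! ### Recognizing matchings. -/

theorem matchingGraph_adj {m : ℕ} {x y : Fin m × Fin 2} :
    (matchingGraph m).Adj x y ↔ x ≠ y ∧ x.1 = y.1 := by
  simp only [matchingGraph, fromRel_adj, ne_eq, and_congr_right_iff]
  intro _
  constructor
  · rintro (h | h)
    exacts [h, h.symm]
  · exact Or.inl

/-- A finite graph of maximum degree at most one spans a matching. -/
theorem spanned_iso_matchingGraph {V : Type*} [Finite V] (H : SimpleGraph V)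
    (hH : ∀ u v w, H.Adj u v → H.Adj u w → v = w) :
    Nonempty (spanned H ≃g matchingGraph (Nat.card H.edgeSet)) := by
  classical
  have hout : ∀ e : H.edgeSet, H.Adj e.1.out.1 e.1.out.2 := fun e => by
    rw [← mem_edgeSet, Sym2.mk, Prod.mk.eta, Quot.out_eq]
    exact e.2
  have hmk : ∀ e : H.edgeSet, e.1 = s(e.1.out.1, e.1.out.2) := fun e => by
    rw [Sym2.mk, Prod.mk.eta, Quot.out_eq]
  let g : H.edgeSet → Fin 2 → V := fun e => ![e.1.out.1, e.1.out.2]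
  have hg : ∀ e i j, i ≠ j → H.Adj (g e i) (g e j) := by
    intro e i j hij
    fin_cases i <;> fin_cases j
    · exact absurd rfl hij
    · exact hout e
    · exact (hout e).symm
    · exact absurd rfl hij
  have hge : ∀ e i j, i ≠ j → e.1 = s(g e i, g e j) := by
    intro e i j hij
    fin_cases i <;> fin_cases j
    · exact absurd rfl hij
    · exact hmk e
    · exact (hmk e).trans Sym2.eq_swap
    · exact absurd rfl hij
  have hother : ∀ i : Fin 2, ∃ j, i ≠ j := by decide
  have hinj : ∀ e i e' i', g e i = g e' i' → e = e' ∧ i = i' := by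
    intro e i e' i' h
    obtain ⟨j, hj⟩ := hother i
    obtain ⟨j', hj'⟩ := hother i'
    have h1 := hH _ _ _ (h ▸ hg e i j hj) (hg e' i' j' hj')
    have he : e = e' := by
      apply Subtype.ext
      rw [hge e i j hj, hge e' i' j' hj', h, h1]
    subst he
    refine ⟨rfl, ?_⟩
    by_contra hne
    exact (hg e i i' hne).ne h
  -- Pairs (edge, choice of end) correspond bijectively to non-isolated vertices, since each lies on
  -- exactly one edge.
  let f : H.edgeSet × Fin 2 → H.support := fun x =>
    ⟨g x.1 x.2, by
      obtain ⟨j, hj⟩ := hother x.2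
      exact ⟨_, hg x.1 x.2 j hj⟩⟩
  have hf : Function.Bijective f := by
    constructor
    · rintro ⟨e, i⟩ ⟨e', i'⟩ h
      obtain ⟨h1, h2⟩ := hinj e i e' i' (congrArg Subtype.val h)
      rw [h1, h2]
    · rintro ⟨u, v, huv⟩
      let e : H.edgeSet := ⟨s(u, v), huv⟩
      have hu : u ∈ s(e.1.out.1, e.1.out.2) := by
        rw [← hmk e]
        exact Sym2.mem_mk_left u v
      rcases Sym2.mem_iff.mp hu with h | h
      · exact ⟨(e, 0), Subtype.ext h.symm⟩
      · exact ⟨(e, 1), Subtype.ext h.symm⟩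
  let E : H.edgeSet × Fin 2 ≃ Fin (Nat.card H.edgeSet) × Fin 2 :=
    (Finite.equivFin H.edgeSet).prodCongr (Equiv.refl _)
  let F : Fin (Nat.card H.edgeSet) × Fin 2 ≃ H.support := E.symm.trans (Equiv.ofBijective f hf)
  refine ⟨(RelIso.mk F ?_ : matchingGraph _ ≃g spanned H).symm⟩
  intro x y
  obtain ⟨⟨e, i⟩, rfl⟩ := E.surjective x
  obtain ⟨⟨e', i'⟩, rfl⟩ := E.surjective y
  have hF : ∀ z, F (E z) = f z := fun z => by
    simp only [F, Equiv.trans_apply, Equiv.symm_apply_apply, Equiv.ofBijective_apply]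
  rw [hF, hF, matchingGraph_adj, E.injective.ne_iff]
  change H.Adj (g e i) (g e' i') ↔ (e, i) ≠ (e', i') ∧
    Finite.equivFin H.edgeSet e = Finite.equivFin H.edgeSet e'
  rw [(Finite.equivFin H.edgeSet).injective.eq_iff]
  constructor
  · intro h
    refine ⟨fun heq => ?_, ?_⟩
    · obtain ⟨rfl, rfl⟩ := Prod.mk.inj heq
      exact h.ne rfl
    · obtain ⟨j, hj⟩ := hother i
      have h1 := hH _ _ _ h (hg e i j hj)
      exact (hinj _ _ _ _ h1).1.symm
  · rintro ⟨hne, rfl⟩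
    exact hg e i i' fun h => hne (by rw [h])

theorem smallMatchings_has {V : Type*} [Finite V] {r : ℕ} {H : SimpleGraph V}
    (hH : ∀ u v w, H.Adj u v → H.Adj u w → v = w) (hne : H ≠ ⊥)
    (hcard : Nat.card H.edgeSet ≤ r) :
    GraphFamily.Has (smallMatchings r) (spanned H) := by
  obtain ⟨e⟩ := spanned_iso_matchingGraph H hH
  have hpos : 1 ≤ Nat.card H.edgeSet := by
    have : Nonempty H.edgeSet := (edgeSet_nonempty.mpr hne).to_subtype
    exact Nat.card_pos
  let i := (matchingGraph (Nat.card H.edgeSet)).overFinIso rfl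
  exact ⟨⟨_, _⟩, ⟨_, hpos, hcard, ⟨i.symm⟩⟩, ⟨e.trans i⟩⟩

/-! ### Basic bounds for `genAntiRamsey`. -/

theorem genAntiRamsey_le {n : ℕ} {V : Type*} {G : SimpleGraph V} {𝓕 : GraphFamily} {m : ℕ}
    (h : ∀ c : EdgeColoring n, m ≤ c.numColors →
      ∃ φ : Copy G (completeGraph (Fin n)), IsDecomposedCopy 𝓕 c φ) :
    genAntiRamsey n G 𝓕 ≤ m :=
  Nat.sInf_le h

theorem lt_genAntiRamsey {n : ℕ} {V : Type*} {G : SimpleGraph V} {𝓕 : GraphFamily}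
    (c : EdgeColoring n)
    (h : ∀ φ : Copy G (completeGraph (Fin n)), ¬ IsDecomposedCopy 𝓕 c φ) :
    c.numColors < genAntiRamsey n G 𝓕 := by
  rw [genAntiRamsey]
  refine Nat.lt_of_not_le fun hle => ?_
  have hmem := Nat.sInf_mem (s := {m : ℕ | ∀ c : EdgeColoring n, m ≤ c.numColors →
    ∃ φ : Copy G (completeGraph (Fin n)), IsDecomposedCopy 𝓕 c φ})
    ⟨(completeGraph (Fin n)).edgeSet.ncard + 1, fun c hc => by
      have := Set.ncard_image_le (f := c) (completeGraph (Fin n)).edgeSet.toFinite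
      rw [EdgeColoring.numColors] at hc
      omega⟩
  obtain ⟨φ, hφ⟩ := hmem c hle
  exact h φ hφ

/-- Enlarging the family can only make `genAntiRamsey` smaller. -/
theorem genAntiRamsey_anti {n : ℕ} {V : Type*} {G : SimpleGraph V} {𝓕 𝓖 : GraphFamily}
    (h : 𝓕 ⊆ 𝓖) : genAntiRamsey n G 𝓖 ≤ genAntiRamsey n G 𝓕 := by
  refine Nat.le_of_not_lt fun hlt => ?_
  have hmem := Nat.sInf_mem (s := {m : ℕ | ∀ c : EdgeColoring n, m ≤ c.numColors →
    ∃ φ : Copy G (completeGraph (Fin n)), IsDecomposedCopy 𝓕 c φ})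
    ⟨(completeGraph (Fin n)).edgeSet.ncard + 1, fun c hc => by
      have := Set.ncard_image_le (f := c) (completeGraph (Fin n)).edgeSet.toFinite
      rw [EdgeColoring.numColors] at hc
      omega⟩
  refine absurd (genAntiRamsey_le fun c hc => ?_) hlt.not_ge
  obtain ⟨φ, hφ⟩ := hmem c hc
  exact ⟨φ, fun k hk => by
    obtain ⟨F, hF, e⟩ := hφ k hk
    exact ⟨F, h hF, e⟩⟩

/-! ### The lower bound. -/

/-- The coloring that is rainbow on `T` and has one further color on the complement of `T`. -/
theorem exists_coloring_rainbow_on {n : ℕ} (T : SimpleGraph (Fin n)) (hT : T ≠ ⊤) :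
    ∃ c : EdgeColoring n, c.numColors = T.edgeSet.ncard + 1 ∧
      ∀ u v, c s(u, v) = 0 ↔ ¬ T.Adj u v := by
  classical
  let c : EdgeColoring n := fun e =>
    if e ∈ T.edgeSet then (Finite.equivFin (Sym2 (Fin n)) e).val + 1 else 0
  have hc : ∀ e, e ∈ T.edgeSet → c e = (Finite.equivFin (Sym2 (Fin n)) e).val + 1 :=
    fun e he => if_pos he
  have hc0 : ∀ e, e ∉ T.edgeSet → c e = 0 := fun e he => if_neg he
  have himage : c '' (completeGraph (Fin n)).edgeSet = insert 0 (c '' T.edgeSet) := by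
    apply Set.Subset.antisymm
    · rintro _ ⟨e, -, rfl⟩
      by_cases he : e ∈ T.edgeSet
      · exact Or.inr ⟨e, he, rfl⟩
      · exact Or.inl (hc0 e he)
    · rintro _ (rfl | ⟨e, he, rfl⟩)
      · obtain ⟨u, v, huv, hn⟩ : ∃ u v, u ≠ v ∧ ¬ T.Adj u v := by
          by_contra! h
          exact hT (by ext u v; exact ⟨fun h => h.ne, h u v⟩)
        exact ⟨s(u, v), huv, hc0 _ hn⟩
      · exact ⟨e, edgeSet_mono le_top he, rfl⟩
  have hinj : Set.InjOn c T.edgeSet := by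
    intro e he e' he' h
    rw [hc e he, hc e' he', Nat.add_right_cancel_iff] at h
    exact (Finite.equivFin _).injective (Fin.ext h)
  refine ⟨c, ?_, fun u v => ?_⟩
  · rw [EdgeColoring.numColors, himage, Set.ncard_insert_of_notMem, hinj.ncard_image]
    rintro ⟨e, he, h⟩
    rw [hc e he] at h
    omega
  · constructor
    · intro h hadj
      rw [hc _ hadj] at h
      omega
    · exact fun h => hc0 _ h

/-- If all pairs of equal values of `h` are edges of a graph spanning `m K_2`, then `h` takes at
least `|V| - m` values. -/
theorem card_le_of_iso_matchingGraph {V α : Type*} [Finite V] [Finite α] {H : SimpleGraph V}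
    {m : ℕ} (h : V → α) (hH : ∀ u v, u ≠ v → h u = h v → H.Adj u v)
    (e : spanned H ≃g matchingGraph m) : Nat.card V ≤ Nat.card α + m := by
  classical
  -- Remove one end of every matching edge: `h` is injective on what remains, and the m removed
  -- vertices are indexed by their edges.
  let f : V → α ⊕ Fin m := fun v =>
    if hv : ∃ j, (e.symm (j, 0) : V) = v then Sum.inr hv.choose else Sum.inl (h v)
  have hf : Function.Injective f := by
    intro u v huv
    by_cases hu : ∃ j, (e.symm (j, 0) : V) = u <;> by_cases hv : ∃ j, (e.symm (j, 0) : V) = v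
    · simp only [f, hu, hv, dif_pos, Sum.inr.injEq] at huv
      rw [← hu.choose_spec, huv, hv.choose_spec]
    · simp [f, hu, hv] at huv
    · simp [f, hu, hv] at huv
    · simp only [f, hu, hv, dif_neg, not_false_eq_true, Sum.inl.injEq] at huv
      by_contra hne
      have hadj := hH u v hne huv
      let u' : H.support := ⟨u, v, hadj⟩
      let v' : H.support := ⟨v, u, hadj.symm⟩
      have h1 : (matchingGraph m).Adj (e u') (e v') := e.map_rel_iff.mpr hadj
      rw [matchingGraph_adj] at h1
      have key : ∀ w : H.support, (¬ ∃ j, (e.symm (j, 0) : V) = w) → (e w).2 = 1 := by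
        intro w hw
        by_contra h2
        refine hw ⟨(e w).1, ?_⟩
        have h3 : ((e w).1, (0 : Fin 2)) = e w := Prod.ext rfl (by grind)
        rw [h3, RelIso.symm_apply_apply]
      exact h1.1 (Prod.ext h1.2 ((key u' hu).trans (key v' hv).symm))
  have := Nat.card_le_card_of_injective f hf
  rwa [Nat.card_sum, Nat.card_fin] at this

/-- The larger family suffices here, since `genAntiRamsey` is antitone in the family. -/
theorem extremalNumber_add_two_le_genAntiRamsey {r p : ℕ} (h1 : 1 ≤ r) (hp : r + 2 ≤ p) {n : ℕ}
    (hn : p ≤ n) :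
    extremalNumber n (completeGraph (Fin (p - r))) + 2 ≤
      genAntiRamsey n (completeGraph (Fin p)) (smallMatchings r ∪ nonMatchingTriangleFree) := by
  classical
  obtain ⟨ρ, hρ⟩ : ∃ ρ, p - r = ρ + 1 := ⟨p - r - 1, by omega⟩
  have hρ1 : 1 ≤ ρ := by omega
  have : Nontrivial (Fin (ρ + 1)) := Fin.nontrivial_iff_two_le.mpr (by omega)
  have hex : extremalNumber n (completeGraph (Fin (p - r))) = (turanGraph n ρ).edgeSet.ncard := by
    rw [hρ, extremalNumber_top, Fintype.card_fin, Nat.add_sub_cancel, Set.ncard_eq_toFinset_card',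
      edgeFinset]
  have hT : turanGraph n ρ ≠ ⊤ := by
    rw [Ne, turanGraph_eq_top]
    omega
  obtain ⟨c, hc, hc0⟩ := exists_coloring_rainbow_on _ hT
  rw [hex]
  suffices h : c.numColors < genAntiRamsey n (completeGraph (Fin p))
      (smallMatchings r ∪ nonMatchingTriangleFree) by omega
  refine lt_genAntiRamsey c fun φ hφ => ?_
  set H := colorClass c φ 0 with hH
  let h : Fin p → Fin ρ := fun v => ⟨φ v % ρ, Nat.mod_lt _ hρ1⟩
  have hadj : ∀ u v, H.Adj u v ↔ u ≠ v ∧ h u = h v := by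
    intro u v
    change u ≠ v ∧ c s(φ u, φ v) = 0 ↔ _
    rw [hc0, turanGraph_adj, not_not, Fin.mk.injEq]
  have hne : H ≠ ⊥ := by
    obtain ⟨u, v, huv, heq⟩ := Fintype.exists_ne_map_eq_of_card_lt h (by simp; omega)
    exact ne_bot_iff_exists_adj.mpr ⟨u, v, (hadj u v).mpr ⟨huv, heq⟩⟩
  obtain ⟨F, hF | hF, ⟨e⟩⟩ := hφ 0 hne
  · obtain ⟨m, -, hm, ⟨e'⟩⟩ := hF
    have := card_le_of_iso_matchingGraph h (fun u v huv heq => (hadj u v).mpr ⟨huv, heq⟩)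
      (e.trans e')
    rw [Nat.card_fin, Nat.card_fin] at this
    omega
  · obtain ⟨hfree, -, hnm⟩ := hF
    -- Being in the same Turán part is transitive, so two edges of `H` at one vertex close a
    -- triangle. A triangle-free class is therefore a matching.
    obtain ⟨e'⟩ := spanned_iso_matchingGraph H (by
      intro u v w huv huw
      by_contra hvw
      have hvw' : H.Adj v w := (hadj v w).mpr
        ⟨hvw, ((hadj u v).mp huv).2.symm.trans ((hadj u w).mp huw).2⟩
      have hs : (spanned H).CliqueFree 3 := hfree.comap ⟨e.toEmbedding.toCopy⟩
      let u' : H.support := ⟨u, v, huv⟩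
      let v' : H.support := ⟨v, u, huv.symm⟩
      let w' : H.support := ⟨w, u, huw.symm⟩
      have huv' : (spanned H).Adj u' v' := huv
      have huw' : (spanned H).Adj u' w' := huw
      have hvw'' : (spanned H).Adj v' w' := hvw'
      exact hs {u', v', w'} (is3Clique_triple_iff.mpr ⟨huv', huw', hvw''⟩))
    exact hnm _ ⟨e.symm.trans e'⟩

/-! ### The upper bound: from a rainbow blow-up to a decomposed clique. -/

/-- A coloring contains a totally multicolored subgraph using every color exactly once. -/
theorem exists_rainbow_subgraph {n : ℕ} (c : EdgeColoring n) :
    ∃ H : SimpleGraph (Fin n), H.edgeSet.ncard = c.numColors ∧ Set.InjOn c H.edgeSet := by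
  obtain ⟨T, hT, hbij⟩ := Set.exists_subset_bijOn (completeGraph (Fin n)).edgeSet c
  have hedge : (fromEdgeSet T).edgeSet = T := by
    rw [edgeSet_fromEdgeSet, sdiff_eq_left, Set.disjoint_left]
    exact fun e he => not_isDiag_of_mem_edgeSet _ (hT he)
  refine ⟨fromEdgeSet T, ?_, ?_⟩
  · rw [hedge, EdgeColoring.numColors, ← hbij.image_eq, hbij.injOn.ncard_image]
  · rw [hedge]
    exact hbij.injOn

/-- For uniformly random x each bad equality has probability 1/s, because the tested coordinate
differs from i; fewer than s such events cannot cover all x. -/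
theorem exists_choice_avoiding {ι : Type*} [Fintype ι] [DecidableEq ι] {s : ℕ}
    (hs : Fintype.card ι < s) (K : ι → Fin s → ι) (Y : ι → Fin s → Fin s)
    (hK : ∀ i a, K i a ≠ i) : ∃ x : ι → Fin s, ∀ i, x (K i (x i)) ≠ Y i (x i) := by
  by_contra! hcon
  -- The union bound as an injection: overwriting the coordinate of a violated condition i loses
  -- nothing, since `x i` is kept and determines both that coordinate and its old value.
  let f : (ι → Fin s) × Fin s → ι × (ι → Fin s) := fun z =>
    let i := (hcon z.1).choose
    (i, Function.update z.1 (K i (z.1 i)) z.2)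
  have hf : Function.Injective f := by
    rintro ⟨x, y⟩ ⟨x', y'⟩ heq
    have hx := (hcon x).choose_spec
    have hx' := (hcon x').choose_spec
    simp only [f, Prod.mk.injEq] at heq
    obtain ⟨hi, hu⟩ := heq
    rw [← hi] at hu hx'
    set i := (hcon x).choose
    have h1 : x i = x' i := by
      have := congrFun hu i
      rwa [Function.update_of_ne (hK _ _).symm, Function.update_of_ne (hK _ _).symm] at this
    rw [← h1] at hu hx'
    set k := K i (x i)
    have h2 : y = y' := by
      have := congrFun hu k
      rwa [Function.update_self, Function.update_self] at this
    have h3 : x = x' := by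
      funext j
      by_cases hj : j = k
      · rw [hj, hx, hx']
      · have := congrFun hu j
        rwa [Function.update_of_ne hj, Function.update_of_ne hj] at this
    rw [h2, h3]
  have := Fintype.card_le_of_injective f hf
  rw [Fintype.card_prod, Fintype.card_prod, Fintype.card_fin, mul_comm] at this
  have hpos : 0 < Fintype.card (ι → Fin s) := by
    have : 0 < s := by omega
    rw [Fintype.card_fun, Fintype.card_fin]
    positivity
  exact absurd (Nat.le_of_mul_le_mul_right this hpos) (by omega)

/-- In a rainbow blow-up of `K_q` one can choose a pair of vertices in every part such that no
edge between two chosen vertices of the same part has the color of an edge between chosen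
vertices of different parts. -/
theorem exists_pairs_avoiding_cross_colors {q s n : ℕ} (hq : 2 ≤ q) (hs : q < s)
    (c : EdgeColoring n) {H : SimpleGraph (Fin n)} (hinj : Set.InjOn c H.edgeSet)
    (g : Fin q × Fin s × Fin 2 → Fin n) (hg : Function.Injective g)
    (hH : ∀ z z', z.1 ≠ z'.1 → H.Adj (g z) (g z')) :
    ∃ x : Fin q → Fin s, ∀ i j j' b b', j ≠ j' →
      c s(g (j, x j, b), g (j', x j', b')) ≠ c s(g (i, x i, 0), g (i, x i, 1)) := by
  -- Rainbowness leaves at most one crossing edge with the color of pair a in part i. It has an end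
  -- outside part i, and not selecting the pair y of that end avoids the edge.
  have key : ∀ i a, ∃ k y, k ≠ i ∧ ∀ z z', z.1 ≠ z'.1 →
      c s(g z, g z') = c s(g (i, a, 0), g (i, a, 1)) →
      (z.1 = k ∧ z.2.1 = y) ∨ (z'.1 = k ∧ z'.2.1 = y) := by
    intro i a
    by_cases hex : ∃ z z', z.1 ≠ z'.1 ∧ z.1 ≠ i ∧
        c s(g z, g z') = c s(g (i, a, 0), g (i, a, 1))
    · obtain ⟨z₀, z₀', hz₀, hi, hc₀⟩ := hex
      refine ⟨z₀.1, z₀.2.1, hi, fun z z' hz hc => ?_⟩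
      have h1 := hinj (hH z z' hz) (hH z₀ z₀' hz₀) (hc.trans hc₀.symm)
      rcases Sym2.eq_iff.mp h1 with ⟨h, -⟩ | ⟨-, h⟩
      · exact Or.inl ⟨by rw [hg h], by rw [hg h]⟩
      · exact Or.inr ⟨by rw [hg h], by rw [hg h]⟩
    · have : Nontrivial (Fin q) := Fin.nontrivial_iff_two_le.mpr hq
      obtain ⟨k, hk⟩ := exists_ne i
      refine ⟨k, a, hk, fun z z' hz hc => absurd ?_ hex⟩
      by_cases hzi : z.1 = i
      · exact ⟨z', z, hz.symm, fun h => hz (hzi.trans h.symm), by rw [Sym2.eq_swap, hc]⟩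
      · exact ⟨z, z', hz, hzi, hc⟩
  choose K Y hK hKY using key
  obtain ⟨x, hx⟩ := exists_choice_avoiding (by rwa [Fintype.card_fin]) K Y hK
  refine ⟨x, fun i j j' b b' hj hc => ?_⟩
  rcases hKY i (x i) _ _ hj hc with ⟨h1, h2⟩ | ⟨h1, h2⟩
  · exact hx i (h1 ▸ h2)
  · exact hx i (h1 ▸ h2)

theorem exists_isDecomposedCopy_of_rainbow {q r s n : ℕ} (hr : 1 ≤ r) (hrq : r ≤ q) (hq : 2 ≤ q)
    (hs : q < s) (c : EdgeColoring n) {H : SimpleGraph (Fin n)} (hinj : Set.InjOn c H.edgeSet)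
    (f : Copy (completeEquipartiteGraph q (s * 2)) H) :
    ∃ φ : Copy (completeGraph (Fin (q + r))) (completeGraph (Fin n)),
      IsDecomposedCopy (smallMatchings r) c φ := by
  classical
  let g : Fin q × Fin s × Fin 2 → Fin n := fun z => f (z.1, finProdFinEquiv z.2)
  have hg : Function.Injective g := by
    intro z z' h
    have h1 := Prod.mk.inj (f.injective h)
    exact Prod.ext h1.1 (finProdFinEquiv.injective h1.2)
  have hH : ∀ z z', z.1 ≠ z'.1 → H.Adj (g z) (g z') := fun z z' h => f.toHom.map_adj h
  obtain ⟨x, hx⟩ := exists_pairs_avoiding_cross_colors hq hs c hinj g hg hH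
  -- The first q vertices of the clique represent all pairs; the last r complete the first r pairs.
  let w : Fin (q + r) → Fin q × Fin 2 := fun v =>
    if h : v.val < q then (⟨v, h⟩, 0) else (⟨v - q, by omega⟩, 1)
  have hw0 : ∀ v (h : v.val < q), w v = (⟨v, h⟩, 0) := fun v h => dif_pos h
  have hw1 : ∀ v (h : ¬ v.val < q), w v = (⟨v - q, by omega⟩, 1) := fun v h => dif_neg h
  have hw : Function.Injective w := by
    intro u v huv
    by_cases hu : u.val < q <;> by_cases hv : v.val < q <;>
      simp [hw0, hw1, hu, hv] at huv <;> omega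
  let ψ : Fin (q + r) → Fin n := fun v => g ((w v).1, x (w v).1, (w v).2)
  have hψ : Function.Injective ψ := by
    intro u v huv
    have h1 := hg huv
    simp only [Prod.mk.injEq] at h1
    exact hw (Prod.ext h1.1 h1.2.2)
  have hinside : ∀ u v, u ≠ v → (w u).1 = (w v).1 →
      s(ψ u, ψ v) = s(g ((w u).1, x (w u).1, 0), g ((w u).1, x (w u).1, 1)) := by
    intro u v huv h
    have h2 : (w u).2 ≠ (w v).2 := fun h2 => huv (hw (Prod.ext h h2))
    simp only [ψ, ← h]
    rcases (by grind : ((w u).2 = 0 ∧ (w v).2 = 1) ∨ ((w u).2 = 1 ∧ (w v).2 = 0)) with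
      ⟨h3, h4⟩ | ⟨h3, h4⟩
    · rw [h3, h4]
    · rw [h3, h4, Sym2.eq_swap]
  let φ : Copy (completeGraph (Fin (q + r))) (completeGraph (Fin n)) :=
    ⟨⟨ψ, fun {u v} h => hψ.ne h⟩, hψ⟩
  refine ⟨φ, fun k hk => ?_⟩
  have hadj : ∀ u v, (colorClass c φ k).Adj u v ↔ u ≠ v ∧ c s(ψ u, ψ v) = k :=
    fun u v => Iff.rfl
  set C := colorClass c φ k
  by_cases hcross : ∃ u v, C.Adj u v ∧ (w u).1 ≠ (w v).1
  · obtain ⟨u₀, v₀, h₀, hne₀⟩ := hcross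
    have hall : ∀ u v, C.Adj u v → s(u, v) = s(u₀, v₀) := by
      intro u v h
      have hc : c s(ψ u₀, ψ v₀) = c s(ψ u, ψ v) :=
        ((hadj _ _).mp h₀).2.trans ((hadj _ _).mp h).2.symm
      by_cases hne : (w u).1 = (w v).1
      · rw [hinside u v h.ne hne] at hc
        exact absurd hc (hx _ _ _ _ _ hne₀)
      · have h1 := hinj (hH _ _ hne₀) (hH _ _ hne) hc
        have h2 : Sym2.map ψ s(u₀, v₀) = Sym2.map ψ s(u, v) := h1
        exact (Sym2.map.injective hψ h2).symm
    refine smallMatchings_has (fun u v v' h h' => ?_) hk ?_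
    · exact Sym2.congr_right.mp ((hall u v h).trans (hall u v' h').symm)
    · have hsub : C.edgeSet ⊆ {s(u₀, v₀)} := by
        intro e he
        induction e with
        | h u v => exact hall u v he
      rw [Nat.card_coe_set_eq]
      exact (Set.ncard_le_ncard hsub).trans ((Set.ncard_singleton _).trans_le hr)
  · push Not at hcross
    refine smallMatchings_has (fun u v v' h h' => ?_) hk ?_
    · have h1 := hcross u v h
      have h2 := hcross u v' h'
      apply hw
      refine Prod.ext (h1.symm.trans h2) ?_
      have h3 : (w u).2 ≠ (w v).2 := fun h3 => h.ne (hw (Prod.ext h1 h3))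
      have h4 : (w u).2 ≠ (w v').2 := fun h4 => h'.ne (hw (Prod.ext h2 h4))
      grind
    · have hsub : C.edgeSet ⊆
          Set.range fun j : Fin r => s((⟨j, by omega⟩ : Fin (q + r)), ⟨q + j, by omega⟩) := by
        intro e he
        induction e with
        | h u v =>
          have h1 := hcross u v he
          have hne : u ≠ v := C.ne_of_adj he
          by_cases hu : u.val < q <;> by_cases hv : v.val < q <;>
            simp only [hw0, hw1, hu, hv, not_false_eq_true, Fin.mk.injEq] at h1
          · exact absurd (Fin.ext h1) hne
          · refine ⟨⟨v - q, by omega⟩, Sym2.eq_iff.mpr (Or.inl ⟨Fin.ext h1.symm, Fin.ext ?_⟩)⟩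
            simp only
            omega
          · refine ⟨⟨u - q, by omega⟩, Sym2.eq_iff.mpr (Or.inr ⟨Fin.ext h1, Fin.ext ?_⟩)⟩
            simp only
            omega
          · exact absurd (Fin.ext (by omega)) hne
      rw [Nat.card_coe_set_eq]
      refine (Set.ncard_le_ncard hsub (Set.finite_range _)).trans ?_
      rw [← Set.image_univ]
      refine (Set.ncard_image_le Set.finite_univ).trans ?_
      rw [Set.ncard_univ, Nat.card_fin]

theorem genAntiRamsey_le_extremalNumber_add_one {q r : ℕ} (hr : 1 ≤ r) (hrq : r ≤ q)
    (hq : 2 ≤ q) (n : ℕ) :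
    genAntiRamsey n (completeGraph (Fin (q + r))) (smallMatchings r) ≤
      extremalNumber n (completeEquipartiteGraph q ((q + 1) * 2)) + 1 := by
  classical
  refine genAntiRamsey_le fun c hc => ?_
  obtain ⟨H, hcard, hinj⟩ := exists_rainbow_subgraph c
  have hlt : extremalNumber (Fintype.card (Fin n)) (completeEquipartiteGraph q ((q + 1) * 2)) <
      H.edgeFinset.card := by
    rw [Fintype.card_fin, edgeFinset, ← Set.ncard_eq_toFinset_card']
    omega
  obtain ⟨f⟩ := IsContained.of_extremalNumber_lt_card_edgeFinset hlt
  exact exists_isDecomposedCopy_of_rainbow hr hrq hq (Nat.lt_succ_self q) c hinj f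

/-! ### Asymptotics and conclusion. -/

theorem eventually_genAntiRamsey_le {q r : ℕ} (hr : 1 ≤ r) (hrq : r ≤ q) (hq : 3 ≤ q)
    {ε : ℝ} (hε : 0 < ε) :
    ∀ᶠ n : ℕ in Filter.atTop,
      (genAntiRamsey n (completeGraph (Fin (q + r))) (smallMatchings r) : ℝ) ≤
        (1 + ε) * extremalNumber n (completeGraph (Fin q)) := by
  obtain ⟨ρ, rfl⟩ : ∃ ρ, q = ρ + 1 := ⟨q - 1, by omega⟩
  have hρ : (2 : ℝ) ≤ ρ := by exact_mod_cast (by omega : 2 ≤ ρ)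
  filter_upwards [Filter.eventually_ge_atTop 2,
    eventually_extremalNumber_completeEquipartiteGraph_le (ρ := ρ) (by omega)
      ((ρ + 1 + 1) * 2) (by positivity : 0 < ε / 4),
    eventually_mul_le_mul_choose_two 1 (by positivity : 0 < ε / 4)] with n hn h1 h2
  have h3 : (genAntiRamsey n (completeGraph (Fin (ρ + 1 + r))) (smallMatchings r) : ℝ) ≤
      extremalNumber n (completeEquipartiteGraph (ρ + 1) ((ρ + 1 + 1) * 2)) + 1 := by
    exact_mod_cast genAntiRamsey_le_extremalNumber_add_one hr hrq (by omega) n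
  have h4 := le_extremalNumber_completeGraph (ρ := ρ) (by omega) hn
  have h5 : (1 : ℝ) / ρ ≤ 1 / 2 := one_div_le_one_div_of_le (by norm_num) hρ
  have hn0 : (0 : ℝ) ≤ n := n.cast_nonneg
  have hc0 : (0 : ℝ) ≤ n.choose 2 := by positivity
  -- Since ρ ≥ 2, ex(n, K_q) has density at least 1/2, so an additive error in C(n, 2) becomes a
  -- relative one.
  have h6 : ε / 2 * (n.choose 2 : ℝ) ≤ ε * ((1 - 1 / ρ) * n.choose 2) := by
    have : (1 / 2 : ℝ) * n.choose 2 ≤ (1 - 1 / ρ) * n.choose 2 :=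
      mul_le_mul_of_nonneg_right (by linarith) hc0
    nlinarith
  have h7 := mul_le_mul_of_nonneg_left h4 (by positivity : 0 ≤ 1 + ε)
  linarith

theorem exists_tendsto_zero_of_eventually_le {g e : ℕ → ℝ} {p : ℕ} (he : ∀ n, p ≤ n → 0 < e n)
    (h : ∀ ε : ℝ, 0 < ε → ∀ᶠ n in Filter.atTop, g n ≤ (1 + ε) * e n) :
    ∃ ε : ℕ → ℝ, Filter.Tendsto ε Filter.atTop (nhds 0) ∧
      ∀ n, p ≤ n → g n ≤ (1 + ε n) * e n := by
  -- Truncating at 0 makes the upper estimate alone sufficient for convergence.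
  refine ⟨fun n => max 0 (g n / e n - 1), ?_, fun n hn => ?_⟩
  · rw [Metric.tendsto_nhds]
    intro δ hδ
    filter_upwards [h (δ / 2) (half_pos hδ), Filter.eventually_ge_atTop p] with n h1 hn
    rw [Real.dist_eq, sub_zero, abs_of_nonneg (le_max_left _ _)]
    refine max_lt hδ ?_
    rw [← div_le_iff₀ (he n hn)] at h1
    linarith
  · have h1 := le_max_right 0 (g n / e n - 1)
    rw [← div_le_iff₀ (he n hn)]
    linarith

theorem theoremt (r p : ℕ) (hrp : (2 ≤ r ∧ 2 * r < p) ∨ (r = 1 ∧ 4 ≤ p)) :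
    ((∀ n : ℕ, p ≤ n →
        extremalNumber n (completeGraph (Fin (p - r))) + 2 ≤
          genAntiRamsey n (completeGraph (Fin p)) (smallMatchings r)) ∧
      ∃ ε : ℕ → ℝ, Filter.Tendsto ε Filter.atTop (nhds 0) ∧ ∀ n : ℕ, p ≤ n →
        (genAntiRamsey n (completeGraph (Fin p)) (smallMatchings r) : ℝ) ≤
          (1 + ε n) * (extremalNumber n (completeGraph (Fin (p - r))) : ℝ)) ∧
    ((∀ n : ℕ, p ≤ n →
        extremalNumber n (completeGraph (Fin (p - r))) + 2 ≤
          genAntiRamsey n (completeGraph (Fin p)) (smallMatchings r ∪ nonMatchingTriangleFree)) ∧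
      ∃ ε : ℕ → ℝ, Filter.Tendsto ε Filter.atTop (nhds 0) ∧ ∀ n : ℕ, p ≤ n →
        (genAntiRamsey n (completeGraph (Fin p))
            (smallMatchings r ∪ nonMatchingTriangleFree) : ℝ) ≤
          (1 + ε n) * (extremalNumber n (completeGraph (Fin (p - r))) : ℝ)) := by
  have hr : 1 ≤ r := by omega
  have hrp' : r + 3 ≤ p := by omega
  have hF : smallMatchings r ⊆ smallMatchings r ∪ nonMatchingTriangleFree :=
    Set.subset_union_left
  have hlow := fun n (hn : p ≤ n) =>
    extremalNumber_add_two_le_genAntiRamsey hr (by omega : r + 2 ≤ p) hn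
  have hpos : ∀ n, p ≤ n → (0 : ℝ) < extremalNumber n (completeGraph (Fin (p - r))) := by
    intro n hn
    obtain ⟨ρ, hρ⟩ : ∃ ρ, p - r = ρ + 1 := ⟨p - r - 1, by omega⟩
    have hρ2 : (2 : ℝ) ≤ ρ := by exact_mod_cast (by omega : 2 ≤ ρ)
    rw [hρ]
    refine lt_of_lt_of_le (mul_pos ?_ ?_)
      (le_extremalNumber_completeGraph (by omega) (by omega : 2 ≤ n))
    · have : (1 : ℝ) / ρ ≤ 1 / 2 := one_div_le_one_div_of_le (by norm_num) hρ2
      linarith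
    · exact_mod_cast Nat.choose_pos (by omega : 2 ≤ n)
  obtain ⟨ε, hε, hup⟩ := exists_tendsto_zero_of_eventually_le hpos fun ε hε => by
    have := eventually_genAntiRamsey_le hr (by omega : r ≤ p - r) (by omega : 3 ≤ p - r) hε
    rwa [Nat.sub_add_cancel (by omega : r ≤ p)] at this
  exact ⟨⟨fun n hn => (hlow n hn).trans (genAntiRamsey_anti hF), ε, hε, hup⟩,
    hlow, ε, hε, fun n hn => le_trans (mod_cast genAntiRamsey_anti hF) (hup n hn)⟩
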